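/- Let $*$ be a continuous t-norm on $[0,1]$, i.e. $([0,1],*,1)$ is a commutative monoid, $*$ is monotone in both arguments, and $*\colon[0,1]\times[0,1]\to[0,1]$ is continuous; let $p\rightarrow q=\bigvee\{r\in[0,1]\mid p*r\leq q\}$ be its residuum. A $[0,1]_*$-set is a set $X$ with a map $\alpha\colon X\times X\to[0,1]$ such that, for all $x,y,z\in X$, $\alpha(x,y)\leq\alpha(x,x)\wedge\alpha(y,y)$, $\alpha(x,y)=\alpha(y,x)$, and $\alpha(y,z)*(\alpha(y,y)\rightarrow\alpha(x,y))\leq\alpha(x,z)$. It is separated if $\alpha(x,x)=\alpha(y,y)=\alpha(x,y)$ implies $x=y$. For $p\in[0,1]$, a singleton on $X$ of extent $p$ is a map $\lambda\colon X\to[0,1]$ such that, for all $y,y'\in X$, $$\lambda(y)\leq p\wedge\alpha(y,y),\quad (\alpha(y,y)\rightarrow\alpha(y,y'))*\lambda(y)\leq\lambda(y'),\quad \lambda(y')*(p\rightarrow\lambda(y))\leq\alpha(y,y'),\quad p\leq\bigvee_{z\in X}\lambda(z)*(\alpha(z,z)\rightarrow\lambda(z)).$$ $X$ is Cauchy complete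 if for every $p\in[0,1]$ and every singleton $\lambda$ on $X$ of extent $p$ there is $x\in X$ with $\lambda=\alpha(x,-)$. A monotone function $f\colon(X,\alpha)\to(Y,\beta)$ is a function $f\colon X\to Y$ with $\alpha(x,x)=\beta(fx,fx)$ and $\alpha(x,x')\leq\beta(fx,fx')$ for all $x,x'\in X$. Proposition. The category of separated Cauchy complete $[0,1]_*$-sets and monotone functions is cartesian closed (it has finite products, and for every object $Y$ the functor $-\times Y$ has a right adjoint) if and only if $*$ is the minimum t-norm, i.e. $p*q=\min\{p,q\}$ for all $p,q\in[0,1]$. -/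

import Mathlib

open CategoryTheory

universe u v w

/-- A continuous t-norm on the unit interval `[0,1]`. -/
structure ContTNorm where
  /-- the binary operation `p * q` -/
  op : unitInterval → unitInterval → unitInterval
  op_assoc : ∀ p q r, op (op p q) r = op p (op q r)
  op_comm : ∀ p q, op p q = op q p
  op_one : ∀ p, op p 1 = p
  op_mono : ∀ p p' q q', p ≤ p' → q ≤ q' → op p q ≤ op p' q'
  op_continuous : Continuous (fun x : unitInterval × unitInterval => op x.1 x.2)

namespace ContTNorm

/-- The residuum `p → q` of a continuous t-norm: the largest `r` with `p * r ≤ q`. -/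
noncomputable def imp (T : ContTNorm) (p q : unitInterval) : unitInterval :=
  sSup {r | T.op p r ≤ q}

theorem op_zero (T : ContTNorm) (p : unitInterval) : T.op p 0 = 0 := by
  apply le_antisymm _ bot_le
  calc T.op p 0 ≤ T.op 1 0 := T.op_mono _ _ _ _ le_top le_rfl
    _ = 0 := by rw [T.op_comm, T.op_one]

/-- The Galois connection that characterizes the residuum. -/
theorem op_le_iff_le_imp (T : ContTNorm) (p q r : unitInterval) :
    T.op p q ≤ r ↔ q ≤ T.imp p r := by
  refine ⟨fun h => le_sSup h, fun h => ?_⟩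
  have hne : {s | T.op p s ≤ r}.Nonempty := ⟨0, by simp [T.op_zero]⟩
  have hc : IsClosed {s | T.op p s ≤ r} :=
    isClosed_le (T.op_continuous.comp (by fun_prop : Continuous fun s => (p, s)))
      continuous_const
  exact (T.op_mono _ _ _ _ le_rfl h).trans (hc.sSup_mem hne)

/-- `T` is the minimum t-norm. -/
def IsMin (T : ContTNorm) : Prop := ∀ p q, T.op p q = p ⊓ q

end ContTNorm

/-- A `[0,1]_*`-set: a set `X` with a map `α : X × X → [0,1]` satisfying
strictness, symmetry and transitivity. -/
structure RSet (T : ContTNorm) where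
  /-- the underlying set -/
  carrier : Type u
  /-- the `[0,1]_*`-valued equality -/
  eqv : carrier → carrier → unitInterval
  eqv_le : ∀ x y, eqv x y ≤ eqv x x ⊓ eqv y y
  eqv_symm : ∀ x y, eqv x y = eqv y x
  eqv_trans : ∀ x y z, T.op (eqv y z) (T.imp (eqv y y) (eqv x y)) ≤ eqv x z

namespace RSet

variable {T : ContTNorm}

/-- The relation `x ≅ y`, i.e. `α(x,x) = α(y,y) = α(x,y)`. -/
def Equivalent (X : RSet.{u} T) (x y : X.carrier) : Prop :=
  X.eqv x x = X.eqv y y ∧ X.eqv y y = X.eqv x y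

/-- `X` is separated if `x ≅ y ↔ x = y`. -/
def IsSeparated (X : RSet.{u} T) : Prop :=
  ∀ x y : X.carrier, X.Equivalent x y ↔ x = y

/-- Morphisms `φ : X ⇸ Y` of `[0,1]_*`-sets. -/
structure IsMorphism (X : RSet.{u} T) (Y : RSet.{v} T)
    (φ : X.carrier → Y.carrier → unitInterval) : Prop where
  le : ∀ x y, φ x y ≤ X.eqv x x ⊓ Y.eqv y y
  congr : ∀ x x' y y',
    T.op (T.op (T.imp (Y.eqv y y) (Y.eqv y y')) (φ x y)) (T.imp (X.eqv x x) (X.eqv x' x))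
      ≤ φ x' y'
  functional : ∀ x y y', T.op (φ x y') (T.imp (X.eqv x x) (φ x y)) ≤ Y.eqv y y'
  total : ∀ x x', X.eqv x x' ≤ ⨆ y, T.op (φ x' y) (T.imp (Y.eqv y y) (φ x y))

/-- The one-element `[0,1]_*`-set `{p}` whose element has extent of existence `p`. -/
def one (T : ContTNorm) (p : unitInterval) : RSet.{0} T where
  carrier := Unit
  eqv _ _ := p
  eqv_le _ _ := by simp
  eqv_symm _ _ := rfl
  eqv_trans _ _ _ :=
    (T.op_mono _ _ _ _ le_rfl le_top).trans (T.op_one p).le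

/-- A singleton on `X` with extent `p`: a morphism `{p} ⇸ X`. -/
def IsSingleton (X : RSet.{u} T) (p : unitInterval) (l : X.carrier → unitInterval) : Prop :=
  IsMorphism (one T p) X (fun _ => l)

/-- `X` is Cauchy complete if every singleton on `X` is of the form `α(x,-)`. -/
def IsCauchyComplete (X : RSet.{u} T) : Prop :=
  ∀ (p : unitInterval) (l : X.carrier → unitInterval), X.IsSingleton p l →
    ∃ x, l = X.eqv x

/-- Monotone functions of `[0,1]_*`-sets. -/
@[ext]
structure MonoFun (X : RSet.{u} T) (Y : RSet.{v} T) where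
  /-- the underlying function -/
  toFun : X.carrier → Y.carrier
  extent : ∀ x, X.eqv x x = Y.eqv (toFun x) (toFun x)
  mono : ∀ x x', X.eqv x x' ≤ Y.eqv (toFun x) (toFun x')

/-- The identity monotone function. -/
def MonoFun.id (X : RSet.{u} T) : MonoFun X X where
  toFun x := x
  extent _ := rfl
  mono _ _ := le_rfl

/-- Composition of monotone functions: first `f`, then `g`. -/
def MonoFun.comp {X : RSet.{u} T} {Y : RSet.{v} T} {Z : RSet.{w} T}
    (f : MonoFun X Y) (g : MonoFun Y Z) : MonoFun X Z where
  toFun x := g.toFun (f.toFun x)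
  extent x := (f.extent x).trans (g.extent _)
  mono x x' := (f.mono x x').trans (g.mono _ _)

/-- The category of `[0,1]_*`-sets and monotone functions. -/
instance : Category (RSet.{u} T) where
  Hom X Y := MonoFun X Y
  id X := MonoFun.id X
  comp f g := MonoFun.comp f g

end RSet

/-- The property of being separated and Cauchy complete. -/
def isSepCauchyComplete (T : ContTNorm) : ObjectProperty (RSet.{u} T) :=
  fun X => X.IsSeparated ∧ X.IsCauchyComplete

/-- The category of separated Cauchy complete `[0,1]_*`-sets and monotone functions, as a
full subcategory of the category of `[0,1]_*`-sets and monotone functions. -/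
abbrev CcRSet (T : ContTNorm) : Type (u + 1) := (isSepCauchyComplete.{u} T).FullSubcategory

/-- `C` is cartesian closed: it has finite products, and taking the product with any fixed
object has a right adjoint. -/
def IsCartesianClosed (C : Type u) [Category.{v} C] : Prop :=
  ∃ _ : CartesianMonoidalCategory C, Nonempty (MonoidalClosed C)

/-! If evaluation out of an exponential exists, it exposes the clash between `*`, by which degrees
of equality compose along a chain, and the infimum, by which they combine in a product. Fix `t` and
put `p = t * t`. Let `A` have two points equal to degree `t` and `B` two points equal to degree `p`,
all of full extent. Two maps `G`, `H` from `B × A` that agree over one point of `A` have transposes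
`A → E` agreeing there. Over the other point the transposes are therefore equal to degree `t * t`,
by a chain through the common value. Pairing this with the two points of `B` costs nothing more,
since `p ⊓ t * t = t * t`, so evaluation forces `t * t ≤ β(G(b, z), H(b', z))`. On the unit interval
with its biresiduum, `G` and `H` can be chosen so that the right side is `t * t * t`. Hence `t² ≤ t³
≤ t⁴`; every element is a square by the intermediate value theorem, so every element is idempotent
and `*` is the minimum (`op_le_eqv_of_agree`, `op_self_le_op_op_self`).

The test objects must be Cauchy complete, so they are replaced by completions by singletons. Maps
given on the finite products extend, because these are dense in the products of the completions
(`isDense_prodToCompletion`, `exists_extension`).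

Conversely, for the minimum every element of a Cauchy complete set restricts to any smaller extent.
The exponential consists of monotone functions with an extent of definition, and currying restricts
both arguments to their common extent, as the product contains only pairs of equal extent. -/

namespace ContTNorm

/-! ### Residuation and divisibility. -/

variable (T : ContTNorm)

instance : Std.Associative T.op := ⟨T.op_assoc⟩

instance : Std.Commutative T.op := ⟨T.op_comm⟩

theorem op_le_left (p q : unitInterval) : T.op p q ≤ p :=
  (T.op_mono _ _ _ _ le_rfl le_top).trans (T.op_one p).le

theorem op_le_right (p q : unitInterval) : T.op p q ≤ q :=
  T.op_comm p q ▸ T.op_le_left q p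

theorem one_op (p : unitInterval) : T.op 1 p = p := by rw [T.op_comm, T.op_one]

variable {T} in
theorem op_le_op_left {q q' : unitInterval} (h : q ≤ q') (p : unitInterval) :
    T.op p q ≤ T.op p q' :=
  T.op_mono _ _ _ _ le_rfl h

variable {T} in
theorem op_le_op_right {q q' : unitInterval} (h : q ≤ q') (p : unitInterval) :
    T.op q p ≤ T.op q' p :=
  T.op_mono _ _ _ _ h le_rfl

theorem op_imp_le (p q : unitInterval) : T.op p (T.imp p q) ≤ q :=
  (T.op_le_iff_le_imp _ _ _).2 le_rfl

variable {T} in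
theorem imp_mono {q q' : unitInterval} (h : q ≤ q') (p : unitInterval) :
    T.imp p q ≤ T.imp p q' :=
  (T.op_le_iff_le_imp _ _ _).1 ((T.op_imp_le p q).trans h)

variable {T} in
theorem imp_eq_one {p q : unitInterval} (h : p ≤ q) : T.imp p q = 1 :=
  le_antisymm le_top ((T.op_le_iff_le_imp _ _ _).1 (by rwa [T.op_one]))

theorem one_imp (p : unitInterval) : T.imp 1 p = p :=
  le_antisymm (T.one_op (T.imp 1 p) ▸ T.op_imp_le 1 p)
    ((T.op_le_iff_le_imp _ _ _).1 (T.one_op p).le)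

variable {T} in
/-- Divisibility of continuous t-norms. -/
theorem op_imp_of_le {p q : unitInterval} (h : q ≤ p) : T.op p (T.imp p q) = q := by
  have hc : Continuous fun s => T.op p s :=
    T.op_continuous.comp (by fun_prop : Continuous fun s => (p, s))
  -- Intermediate value theorem: `s ↦ p * s` runs from `0` to `p`, hence takes the value `q`.
  obtain ⟨r, hr⟩ := mem_range_of_exists_le_of_exists_ge hc
    ⟨0, (T.op_zero p).le.trans bot_le⟩ ⟨1, h.trans (T.op_one p).ge⟩
  refine le_antisymm (T.op_imp_le p q) ?_
  calc q = T.op p r := hr.symm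
    _ ≤ _ := op_le_op_left ((T.op_le_iff_le_imp _ _ _).1 (le_of_eq hr)) p

/-- Every element of the unit interval is a square. -/
theorem exists_op_self_eq (p : unitInterval) : ∃ t, T.op t t = p := by
  have hc : Continuous fun s => T.op s s :=
    T.op_continuous.comp (by fun_prop : Continuous fun s => (s, s))
  exact mem_range_of_exists_le_of_exists_ge hc
    ⟨0, (T.op_zero 0).le.trans bot_le⟩ ⟨1, le_top.trans (T.op_one 1).ge⟩

-- By divisibility both sides are `p * (p → q) * (p → r)`. This symmetry lets either factor of a
-- composite over `p` carry the residuum.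
variable {T} in
theorem op_imp_swap {p q r : unitInterval} (hq : q ≤ p) (hr : r ≤ p) :
    T.op q (T.imp p r) = T.op r (T.imp p q) := by
  calc T.op q (T.imp p r) = T.op (T.op p (T.imp p q)) (T.imp p r) := by rw [op_imp_of_le hq]
    _ = T.op (T.op p (T.imp p r)) (T.imp p q) := by ac_rfl
    _ = _ := by rw [op_imp_of_le hr]

variable {T} in
theorem imp_op_le {a b c k : unitInterval} (h : T.op b k ≤ c) :
    T.op (T.imp a b) k ≤ T.imp a c := by
  rw [← T.op_le_iff_le_imp, ← T.op_assoc]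
  exact (op_le_op_right (T.op_imp_le a b) k).trans h

theorem op_iSup {ι : Sort*} (a : unitInterval) (f : ι → unitInterval) :
    T.op a (⨆ i, f i) = ⨆ i, T.op a (f i) := by
  refine le_antisymm ?_ (iSup_le fun i => op_le_op_left (le_iSup f i) a)
  rw [T.op_le_iff_le_imp]
  exact iSup_le fun i => (T.op_le_iff_le_imp _ _ _).1 (le_iSup (fun i => T.op a (f i)) i)

theorem iSup_op {ι : Sort*} (a : unitInterval) (f : ι → unitInterval) :
    T.op (⨆ i, f i) a = ⨆ i, T.op (f i) a := by
  simp only [T.op_comm _ a, T.op_iSup]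

variable {T} in
theorem isMin_of_idempotent (h : ∀ p, p ≤ T.op p p) : T.IsMin := by
  intro p q
  refine le_antisymm (le_inf (T.op_le_left p q) (T.op_le_right p q)) ?_
  exact (h _).trans (T.op_mono _ _ _ _ inf_le_left inf_le_right)

end ContTNorm

open ContTNorm

namespace RSet

variable {T : ContTNorm}

/-! ### Elementary properties of the valued equality. -/

section Basic

variable (X : RSet.{u} T)

theorem eqv_le_left (x y : X.carrier) : X.eqv x y ≤ X.eqv x x := (X.eqv_le x y).trans inf_le_left

theorem eqv_le_right (x y : X.carrier) : X.eqv x y ≤ X.eqv y y :=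
  (X.eqv_le x y).trans inf_le_right

theorem eqv_op_imp (x y z : X.carrier) :
    T.op (X.eqv x y) (T.imp (X.eqv y y) (X.eqv y z)) ≤ X.eqv x z := by
  have := X.eqv_trans z y x
  rwa [X.eqv_symm z y, X.eqv_symm z x, X.eqv_symm y x] at this

variable {X} in
theorem Equivalent.symm {x y : X.carrier} (h : X.Equivalent x y) : X.Equivalent y x :=
  ⟨h.1.symm, by rw [h.1, h.2, X.eqv_symm]⟩

variable {X} in
theorem Equivalent.eqv_eq {x y : X.carrier} (h : X.Equivalent x y) : X.eqv x = X.eqv y := by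
  have key : ∀ {x y : X.carrier}, X.Equivalent x y → ∀ z, X.eqv x z ≤ X.eqv y z := by
    intro x y h z
    have := X.eqv_trans y x z
    rwa [imp_eq_one (by rw [X.eqv_symm y x, ← h.2, h.1]), T.op_one] at this
  exact funext fun z => le_antisymm (key h z) (key h.symm z)

variable {X} in
theorem IsSeparated.eq {x y : X.carrier} (h : X.IsSeparated) {p : unitInterval}
    (hx : X.eqv x x = p) (hy : X.eqv y y = p) (hxy : p ≤ X.eqv x y) : x = y :=
  (h x y).1 ⟨hx.trans hy.symm,
    le_antisymm (hy.le.trans hxy) (X.eqv_le_right x y)⟩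

variable {X} in
theorem isSeparated_of_imp_eq (h : ∀ x y, X.Equivalent x y → x = y) : X.IsSeparated :=
  fun x y => ⟨h x y, by rintro rfl; exact ⟨rfl, rfl⟩⟩

end Basic

/-! ### Singletons. -/

section Singleton

variable {X : RSet.{u} T} {p : unitInterval} {l m : X.carrier → unitInterval}

namespace IsSingleton

theorem le_extent (h : X.IsSingleton p l) (y : X.carrier) : l y ≤ p :=
  (h.le () y).trans inf_le_left

theorem le_eqv (h : X.IsSingleton p l) (y : X.carrier) : l y ≤ X.eqv y y :=
  (h.le () y).trans inf_le_right

theorem op_imp_le (h : X.IsSingleton p l) (y y' : X.carrier) :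
    T.op (l y) (T.imp (X.eqv y y) (X.eqv y y')) ≤ l y' := by
  have := h.congr () () y y'
  rwa [show T.imp ((one T p).eqv () ()) ((one T p).eqv () ()) = 1 from imp_eq_one le_rfl,
    T.op_one, T.op_comm] at this

theorem op_imp_le_eqv (h : X.IsSingleton p l) (y y' : X.carrier) :
    T.op (l y') (T.imp p (l y)) ≤ X.eqv y y' :=
  h.functional () y y'

theorem le_iSup (h : X.IsSingleton p l) : p ≤ ⨆ z, T.op (l z) (T.imp (X.eqv z z) (l z)) :=
  h.total () ()

theorem of_conditions (h₁ : ∀ y, l y ≤ p) (h₂ : ∀ y, l y ≤ X.eqv y y)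
    (h₃ : ∀ y y', T.op (l y) (T.imp (X.eqv y y) (X.eqv y y')) ≤ l y')
    (h₄ : ∀ y y', T.op (l y') (T.imp p (l y)) ≤ X.eqv y y')
    (h₅ : p ≤ ⨆ z, T.op (l z) (T.imp (X.eqv z z) (l z))) : X.IsSingleton p l where
  le _ y := le_inf (h₁ y) (h₂ y)
  congr _ _ y y' := by
    refine (T.op_le_left _ _).trans ?_
    rw [T.op_comm]
    exact h₃ y y'
  functional _ y y' := h₄ y y'
  total _ _ := h₅

/-- Totality of `l` inserts a point `z` into `m y`; functionality of `m` bounds the result by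
`α(y,z)`, along which `l z` is carried to `l y`. Later proofs of Cauchy completeness thus need only
one inequality. -/
theorem eq_of_le (hl : X.IsSingleton p l) (hm : X.IsSingleton p m) (h : ∀ y, l y ≤ m y) :
    l = m := by
  refine funext fun y => le_antisymm (h y) ?_
  rw [← op_imp_of_le (T := T) (hm.le_extent y)]
  refine (op_le_op_right hl.le_iSup _).trans ?_
  rw [T.iSup_op]
  refine iSup_le fun z => ?_
  calc T.op (T.op (l z) (T.imp (X.eqv z z) (l z))) (T.imp p (m y))
      ≤ T.op (T.op (m z) (T.imp (X.eqv z z) (l z))) (T.imp p (m y)) :=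
        op_le_op_right (op_le_op_right (h z) _) _
    _ = T.op (T.op (m z) (T.imp p (m y))) (T.imp (X.eqv z z) (l z)) := by ac_rfl
    _ ≤ T.op (X.eqv y z) (T.imp (X.eqv z z) (l z)) :=
        op_le_op_right (hm.op_imp_le_eqv y z) _
    _ = T.op (l z) (T.imp (X.eqv z z) (X.eqv z y)) := by
        rw [op_imp_swap (X.eqv_le_right y z) (hl.le_eqv z), X.eqv_symm y z]
    _ ≤ l y := hl.op_imp_le z y

theorem extent_eq {x : X.carrier} (h : X.IsSingleton p (X.eqv x)) : X.eqv x x = p :=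
  le_antisymm (h.le_extent x) (h.le_iSup.trans (iSup_le fun z =>
    (T.op_le_left _ _).trans (X.eqv_le_left x z)))

end IsSingleton

end Singleton

/-! ### Dense isometries. -/

section Dense

variable {D : RSet.{v} T} {X : RSet.{u} T}

/-- Distance preserving maps. -/
def IsIsometry (i : D.carrier → X.carrier) : Prop := ∀ d d', X.eqv (i d) (i d') = D.eqv d d'

/-- Every element of `X` is a limit of elements of the image of `i`. -/
def IsDense (i : D.carrier → X.carrier) : Prop :=
  ∀ x, X.eqv x x ≤ ⨆ d, T.op (X.eqv x (i d)) (T.imp (X.eqv (i d) (i d)) (X.eqv (i d) x))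

theorem IsSingleton.comp_dense {i : D.carrier → X.carrier} (hi : IsIsometry i) (hd : IsDense i)
    {p : unitInterval} {l : X.carrier → unitInterval} (hl : X.IsSingleton p l) :
    D.IsSingleton p (fun d => l (i d)) := by
  refine .of_conditions (fun y => hl.le_extent _) (fun y => hi y y ▸ hl.le_eqv _)
    (fun y y' => ?_) (fun y y' => hi y y' ▸ hl.op_imp_le_eqv _ _) (hl.le_iSup.trans ?_)
  · rw [← hi, ← hi]
    exact hl.op_imp_le _ _
  refine iSup_le fun x => ?_
  -- This exposes `α(x,x)`, to which density applies, and leaves two copies of `α(x,x) → l x`, one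
  -- for each of the two factors linking `x` to `i d`.
  nth_rewrite 1 [← op_imp_of_le (hl.le_eqv x)]
  rw [T.op_assoc]
  refine (op_le_op_right (hd x) _).trans ?_
  rw [T.iSup_op]
  refine iSup_mono fun d => ?_
  rw [← hi d d]
  calc T.op (T.op (X.eqv x (i d)) (T.imp (X.eqv (i d) (i d)) (X.eqv (i d) x)))
        (T.op (T.imp (X.eqv x x) (l x)) (T.imp (X.eqv x x) (l x)))
      = T.op (T.op (X.eqv x (i d)) (T.imp (X.eqv x x) (l x)))
        (T.op (T.imp (X.eqv (i d) (i d)) (X.eqv (i d) x)) (T.imp (X.eqv x x) (l x))) := by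
        ac_rfl
    _ ≤ _ := by
      have key : T.op (X.eqv x (i d)) (T.imp (X.eqv x x) (l x)) ≤ l (i d) := by
        rw [op_imp_swap (X.eqv_le_left _ _) (hl.le_eqv x)]
        exact hl.op_imp_le _ _
      refine T.op_mono _ _ _ _ key (imp_op_le ?_)
      rwa [X.eqv_symm]

theorem isDense_id : IsDense (fun x : X.carrier => x) := fun x =>
  le_iSup_of_le x (by rw [imp_eq_one le_rfl, T.op_one])

theorem isSingleton_eqv (x : X.carrier) : X.IsSingleton (X.eqv x x) (X.eqv x) := by
  refine .of_conditions (fun y => X.eqv_le_left x y) (fun y => X.eqv_le_right x y)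
    (fun y y' => X.eqv_op_imp x y y') (fun y y' => ?_) (isDense_id x |>.trans ?_)
  · rw [X.eqv_symm x y]
    exact X.eqv_trans y x y'
  · simp only [X.eqv_symm _ x, le_refl]

end Dense

/-! ### Images of singletons. -/

section Pushforward

variable {X : RSet.{u} T} {Y : RSet.{v} T}

/-- The image of a singleton under a monotone function. -/
noncomputable def pushforward (f : MonoFun X Y) (l : X.carrier → unitInterval)
    (y : Y.carrier) : unitInterval :=
  ⨆ x, T.op (l x) (T.imp (X.eqv x x) (Y.eqv (f.toFun x) y))

theorem le_pushforward (f : MonoFun X Y) (l : X.carrier → unitInterval) (x : X.carrier) :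
    l x ≤ pushforward f l (f.toFun x) :=
  le_iSup_of_le x (by rw [imp_eq_one (f.extent x).le, T.op_one])

theorem IsSingleton.pushforward (f : MonoFun X Y) {p : unitInterval}
    {l : X.carrier → unitInterval} (hl : X.IsSingleton p l) :
    Y.IsSingleton p (pushforward f l) := by
  have hle : ∀ y, RSet.pushforward f l y ≤ p := fun y =>
    iSup_le fun x => (T.op_le_left _ _).trans (hl.le_extent x)
  refine .of_conditions hle (fun y => iSup_le fun x => ?_) (fun y y' => ?_) (fun y y' => ?_)
    (hl.le_iSup.trans (iSup_le fun x => le_iSup_of_le (f.toFun x) ?_))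
  · exact (op_le_op_right (hl.le_eqv x) _).trans
      ((T.op_imp_le _ _).trans (Y.eqv_le_right _ _))
  · rw [RSet.pushforward, T.iSup_op]
    refine iSup_mono fun x => ?_
    rw [T.op_assoc]
    exact op_le_op_left (imp_op_le (Y.eqv_op_imp _ _ _)) _
  -- The swaps expose the suprema one at a time. Two sources `x`, `x'` are then compared by
  -- functionality of `l`, moved to `Y` by `f`, and chained with `y` and `y'`.
  · rw [op_imp_swap (hle y') (hle y), RSet.pushforward, T.iSup_op]
    refine iSup_le fun x => ?_
    rw [T.op_assoc, T.op_comm (T.imp (X.eqv x x) _), ← T.op_assoc,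
      op_imp_swap (hl.le_extent x) (hle y'), RSet.pushforward, T.iSup_op, T.iSup_op]
    refine iSup_le fun x' => ?_
    calc T.op (T.op (T.op (l x') (T.imp (X.eqv x' x') (Y.eqv (f.toFun x') y')))
          (T.imp p (l x))) (T.imp (X.eqv x x) (Y.eqv (f.toFun x) y))
        = T.op (T.op (T.op (l x') (T.imp p (l x)))
          (T.imp (X.eqv x' x') (Y.eqv (f.toFun x') y')))
          (T.imp (X.eqv x x) (Y.eqv (f.toFun x) y)) := by ac_rfl
      _ ≤ T.op (T.op (Y.eqv (f.toFun x) (f.toFun x'))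
          (T.imp (X.eqv x' x') (Y.eqv (f.toFun x') y')))
          (T.imp (X.eqv x x) (Y.eqv (f.toFun x) y)) :=
          op_le_op_right (op_le_op_right ((hl.op_imp_le_eqv x x').trans (f.mono x x')) _) _
      _ ≤ T.op (Y.eqv (f.toFun x) y') (T.imp (X.eqv x x) (Y.eqv (f.toFun x) y)) := by
          rw [f.extent x']
          exact op_le_op_right (Y.eqv_op_imp _ _ _) _
      _ ≤ Y.eqv y y' := by
          rw [f.extent x, Y.eqv_symm _ y]
          exact Y.eqv_trans _ _ _
  · rw [f.extent x]
    exact T.op_mono _ _ _ _ (le_pushforward f l x) (imp_mono (le_pushforward f l x) _)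

end Pushforward

/-! ### Extension along dense isometries. -/

section Extension

variable {D : RSet.{v} T} {X : RSet.{u} T} {W : RSet.{w} T}

theorem IsDense.eqv_le {i : D.carrier → X.carrier} (hd : IsDense i) (x x' : X.carrier) :
    X.eqv x x' ≤ ⨆ d, T.op (X.eqv x (i d)) (T.imp (X.eqv (i d) (i d)) (X.eqv (i d) x')) := by
  rw [← op_imp_of_le (T := T) (X.eqv_le_left x x')]
  refine (op_le_op_right (hd x) _).trans ?_
  rw [T.iSup_op]
  refine iSup_mono fun d => ?_
  rw [T.op_assoc]
  exact op_le_op_left (imp_op_le (X.eqv_op_imp _ _ _)) _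

/-- Monotone functions into Cauchy complete sets extend along dense isometries. -/
theorem exists_extension {i : D.carrier → X.carrier} (hi : IsIsometry i) (hd : IsDense i)
    (hW : W.IsSeparated) (hc : W.IsCauchyComplete) (f : MonoFun D W) :
    ∃ F : MonoFun X W, ∀ d, F.toFun (i d) = f.toFun d := by
  have hs : ∀ x, W.IsSingleton (X.eqv x x) (pushforward f fun d => X.eqv x (i d)) := fun x =>
    ((isSingleton_eqv x).comp_dense hi hd).pushforward f
  -- `F x` represents the image under `f` of the trace of `α(x,-)` on `D`.
  choose F hF using fun x => hc _ _ (hs x)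
  have hext : ∀ x, W.eqv (F x) (F x) = X.eqv x x := fun x => (hF x ▸ hs x).extent_eq
  have hle : ∀ x d, X.eqv x (i d) ≤ W.eqv (F x) (f.toFun d) := fun x d => by
    rw [← hF x]
    exact le_pushforward f (fun d => X.eqv x (i d)) d
  refine ⟨⟨F, fun x => (hext x).symm, fun x x' => ?_⟩, fun d => ?_⟩
  · refine (hd.eqv_le x x').trans ?_
    rw [← hF x]
    refine iSup_mono fun d => ?_
    rw [hi d d, X.eqv_symm (i d) x', W.eqv_symm _ (F x')]
    exact op_le_op_left (imp_mono (hle x' d) _) _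
  · exact hW.eq (hext _) (by rw [hi d d, f.extent]) (hle (i d) d)

/-- Monotone functions that agree on a dense subset are equal. -/
theorem IsDense.monoFun_ext {i : D.carrier → X.carrier} (hd : IsDense i) (hW : W.IsSeparated)
    {F G : MonoFun X W} (h : ∀ d, F.toFun (i d) = G.toFun (i d)) : F = G := by
  refine MonoFun.ext (funext fun x => ?_)
  refine hW.eq (F.extent x).symm (G.extent x).symm ((hd x).trans (iSup_le fun d => ?_))
  refine le_trans ?_ (W.eqv_op_imp (F.toFun x) (F.toFun (i d)) (G.toFun x))
  refine T.op_mono _ _ _ _ (F.mono _ _) ?_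
  rw [← F.extent, h d]
  exact imp_mono (G.mono _ _) _

end Extension

/-! ### The Cauchy completion. -/

section Completion

variable (X : RSet.{u} T)

/-- The singletons of `X`, together with their extents. -/
abbrev Singletons : Type u :=
  {s : unitInterval × (X.carrier → unitInterval) // X.IsSingleton s.1 s.2}

/-- The degree to which two singletons coincide. -/
noncomputable def singletonEqv (s t : X.Singletons) : unitInterval :=
  ⨆ z, T.op (s.1.2 z) (T.imp (X.eqv z z) (t.1.2 z))

theorem singletonEqv_self (s : X.Singletons) : X.singletonEqv s s = s.1.1 :=
  le_antisymm (iSup_le fun z => (T.op_le_left _ _).trans (s.2.le_extent z)) s.2.le_iSup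

theorem singletonEqv_symm (s t : X.Singletons) : X.singletonEqv s t = X.singletonEqv t s :=
  iSup_congr fun z => op_imp_swap (s.2.le_eqv z) (t.2.le_eqv z)

theorem singletonEqv_le (s t : X.Singletons) : X.singletonEqv s t ≤ s.1.1 :=
  iSup_le fun z => (T.op_le_left _ _).trans (s.2.le_extent z)

/-- The Cauchy completion of a `[0,1]_*`-set. -/
noncomputable def completion : RSet.{u} T where
  carrier := X.Singletons
  eqv := X.singletonEqv
  eqv_le s t := by
    rw [singletonEqv_self, singletonEqv_self]
    exact le_inf (X.singletonEqv_le s t) (X.singletonEqv_symm s t ▸ X.singletonEqv_le t s)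
  eqv_symm := X.singletonEqv_symm
  eqv_trans l m n := by
    rw [singletonEqv_self, singletonEqv_symm X l m,
      op_imp_swap (X.singletonEqv_le m n) (X.singletonEqv_le m l)]
    nth_rewrite 1 [singletonEqv]
    rw [T.iSup_op]
    refine iSup_le fun z => ?_
    rw [T.op_assoc, T.op_comm (T.imp (X.eqv z z) _), ← T.op_assoc,
      op_imp_swap (m.2.le_extent z) (X.singletonEqv_le m n)]
    nth_rewrite 1 [singletonEqv]
    rw [T.iSup_op, T.iSup_op]
    refine iSup_le fun y => le_iSup_of_le y ?_
    have key : T.op (T.op (m.1.2 y) (T.imp m.1.1 (m.1.2 z))) (T.imp (X.eqv z z) (l.1.2 z))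
        ≤ l.1.2 y := by
      refine (op_le_op_right (m.2.op_imp_le_eqv z y) _).trans ?_
      rw [op_imp_swap (X.eqv_le_left z y) (l.2.le_eqv z)]
      exact l.2.op_imp_le z y
    calc T.op (T.op (T.op (m.1.2 y) (T.imp (X.eqv y y) (n.1.2 y))) (T.imp m.1.1 (m.1.2 z)))
          (T.imp (X.eqv z z) (l.1.2 z))
        = T.op (T.op (T.op (m.1.2 y) (T.imp m.1.1 (m.1.2 z))) (T.imp (X.eqv z z) (l.1.2 z)))
          (T.imp (X.eqv y y) (n.1.2 y)) := by ac_rfl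
      _ ≤ _ := op_le_op_right key _

/-- The representable singletons. -/
def toCompletion (x : X.carrier) : X.completion.carrier :=
  ⟨(X.eqv x x, X.eqv x), isSingleton_eqv x⟩

/-- The Yoneda lemma for singletons. -/
theorem completion_eqv_toCompletion (x : X.carrier) (s : X.completion.carrier) :
    X.completion.eqv (X.toCompletion x) s = s.1.2 x := by
  refine le_antisymm (iSup_le fun z => ?_) (le_iSup_of_le x ?_)
  · change T.op (X.eqv x z) _ ≤ _
    rw [op_imp_swap (X.eqv_le_right x z) (s.2.le_eqv z), X.eqv_symm x z]
    exact s.2.op_imp_le z x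
  · change _ ≤ T.op (X.eqv x x) _
    rw [op_imp_of_le (s.2.le_eqv x)]

theorem isIsometry_toCompletion : IsIsometry X.toCompletion := fun x y => by
  rw [completion_eqv_toCompletion, X.eqv_symm]
  rfl

theorem isDense_toCompletion : IsDense X.toCompletion := fun s => by
  simp only [X.completion.eqv_symm s (X.toCompletion _), completion_eqv_toCompletion]
  exact (X.singletonEqv_self s).trans_le s.2.le_iSup

theorem completion_isSeparated : X.completion.IsSeparated :=
  isSeparated_of_imp_eq fun s t h => by
    refine Subtype.ext (Prod.ext ?_ (funext fun x => ?_))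
    · have := h.1
      exact (X.singletonEqv_self s).symm.trans (this.trans (X.singletonEqv_self t))
    · rw [← completion_eqv_toCompletion, ← completion_eqv_toCompletion, X.completion.eqv_symm,
        h.eqv_eq, X.completion.eqv_symm]

/-- The trace of `l` on the representables is a singleton on `X`, hence a point of the completion,
and this point represents `l`. -/
theorem completion_isCauchyComplete : X.completion.IsCauchyComplete := fun p l hl => by
  have hs := hl.comp_dense X.isIsometry_toCompletion X.isDense_toCompletion
  let s : X.completion.carrier := ⟨(p, _), hs⟩
  have hsp : X.completion.eqv s s = p := X.singletonEqv_self s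
  refine ⟨s, (IsSingleton.eq_of_le (hsp ▸ isSingleton_eqv s) hl fun t => ?_).symm⟩
  refine iSup_le fun d => ?_
  rw [← completion_eqv_toCompletion X d t, ← X.isIsometry_toCompletion d d]
  exact hl.op_imp_le _ _

end Completion

/-! ### Binary products. -/

section Prod

variable (X : RSet.{u} T) (Y : RSet.{v} T)

/-- The product of `[0,1]_*`-sets: pairs of elements of equal extent. -/
def prod : RSet.{max u v} T where
  carrier := {z : X.carrier × Y.carrier // X.eqv z.1 z.1 = Y.eqv z.2 z.2}
  eqv z z' := X.eqv z.1.1 z'.1.1 ⊓ Y.eqv z.1.2 z'.1.2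
  eqv_le z z' := le_inf (inf_le_inf (X.eqv_le_left _ _) (Y.eqv_le_left _ _))
    (inf_le_inf (X.eqv_le_right _ _) (Y.eqv_le_right _ _))
  eqv_symm z z' := by rw [X.eqv_symm, Y.eqv_symm]
  eqv_trans a b c := by
    rw [← b.2, inf_idem]
    refine le_inf ?_ ?_
    · exact (T.op_mono _ _ _ _ inf_le_left (imp_mono inf_le_left _)).trans (X.eqv_trans _ _ _)
    · rw [b.2]
      exact (T.op_mono _ _ _ _ inf_le_right (imp_mono inf_le_right _)).trans
        (Y.eqv_trans _ _ _)

variable {X Y}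

theorem prod_eqv_self (z : (X.prod Y).carrier) : (X.prod Y).eqv z z = X.eqv z.1.1 z.1.1 := by
  change _ ⊓ _ = _
  rw [← z.2, inf_idem]

variable (X Y) in
/-- The first projection. -/
def prodFst : MonoFun (X.prod Y) X where
  toFun z := z.1.1
  extent z := prod_eqv_self z
  mono _ _ := inf_le_left

variable (X Y) in
/-- The second projection. -/
def prodSnd : MonoFun (X.prod Y) Y where
  toFun z := z.1.2
  extent z := (prod_eqv_self z).trans z.2
  mono _ _ := inf_le_right

/-- The universal property of the product. -/
def prodLift {Z : RSet.{w} T} (f : MonoFun Z X) (g : MonoFun Z Y) : MonoFun Z (X.prod Y) where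
  toFun z := ⟨(f.toFun z, g.toFun z), (f.extent z).symm.trans (g.extent z)⟩
  extent z := (f.extent z).trans (prod_eqv_self (X := X) (Y := Y) ⟨(f.toFun z, g.toFun z), _⟩).symm
  mono z z' := le_inf (f.mono z z') (g.mono z z')

theorem prod_isSeparated (hX : X.IsSeparated) (hY : Y.IsSeparated) : (X.prod Y).IsSeparated :=
  isSeparated_of_imp_eq fun a b h => by
    have h₁ : X.eqv a.1.1 a.1.1 = X.eqv b.1.1 b.1.1 := by
      rw [← prod_eqv_self, ← prod_eqv_self, h.1]
    have h₂ : X.eqv b.1.1 b.1.1 ≤ X.eqv a.1.1 b.1.1 ⊓ Y.eqv a.1.2 b.1.2 := by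
      rw [← prod_eqv_self]
      exact h.2.le
    refine Subtype.ext (Prod.ext (hX.eq h₁ rfl (h₂.trans inf_le_left))
      (hY.eq ?_ b.2.symm (h₂.trans inf_le_right)))
    rw [← a.2, h₁]

/-- The images of `l` under the projections are represented by points of the same extent, which form
a pair; that pair represents `l`. -/
theorem prod_isCauchyComplete (hX : X.IsCauchyComplete) (hY : Y.IsCauchyComplete) :
    (X.prod Y).IsCauchyComplete := fun p l hl => by
  have hl₁ := hl.pushforward (prodFst X Y)
  have hl₂ := hl.pushforward (prodSnd X Y)
  obtain ⟨x, hx⟩ := hX _ _ hl₁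
  obtain ⟨y, hy⟩ := hY _ _ hl₂
  have ex := (hx ▸ hl₁).extent_eq
  have ey := (hy ▸ hl₂).extent_eq
  let z : (X.prod Y).carrier := ⟨(x, y), ex.trans ey.symm⟩
  have ez : (X.prod Y).eqv z z = p := (prod_eqv_self z).trans ex
  refine ⟨z, hl.eq_of_le (ez ▸ isSingleton_eqv z) fun a => le_inf ?_ ?_⟩
  · change _ ≤ X.eqv x a.1.1
    rw [← hx]
    exact le_pushforward (prodFst X Y) l a
  · change _ ≤ Y.eqv y a.1.2
    rw [← hy]
    exact le_pushforward (prodSnd X Y) l a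

end Prod

/-! ### Density in products of completions of finite sets. -/

section FiniteDense

variable {A : RSet.{u} T} {B : RSet.{v} T}

theorem exists_extent_le_eqv_toCompletion [Finite A.carrier] [Nonempty A.carrier]
    (hA : ∀ a, A.eqv a a = 1) (s : A.completion.carrier) :
    ∃ a, A.completion.eqv s s ≤ A.completion.eqv s (A.toCompletion a) ∧
      A.completion.eqv s s ≤ T.op (A.completion.eqv s s) (A.completion.eqv s s) := by
  obtain ⟨a, ha⟩ := exists_eq_ciSup_of_finite
    (f := fun a => T.op (s.1.2 a) (T.imp (A.eqv a a) (s.1.2 a)))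
  have hs : A.completion.eqv s s = s.1.1 := A.singletonEqv_self s
  -- Finiteness makes the supremum in totality a maximum, attained at `a`, and full extents turn its
  -- residuum into `s a`.
  have key : s.1.1 ≤ T.op (s.1.2 a) (s.1.2 a) := by
    have := s.2.le_iSup.trans ha.ge
    simpa only [hA, T.one_imp] using this
  refine ⟨a, ?_, ?_⟩
  · rw [A.completion.eqv_symm s (A.toCompletion a), completion_eqv_toCompletion, hs]
    exact key.trans (T.op_le_left _ _)
  · rw [hs]
    exact key.trans (T.op_mono _ _ _ _ (s.2.le_extent a) (s.2.le_extent a))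

variable (A B) in
/-- The canonical map from a product to the product of the completions. -/
def prodToCompletion (z : (A.prod B).carrier) : (A.completion.prod B.completion).carrier :=
  ⟨(A.toCompletion z.1.1, B.toCompletion z.1.2), by
    rw [A.isIsometry_toCompletion, B.isIsometry_toCompletion, z.2]⟩

theorem isIsometry_prodToCompletion : IsIsometry (prodToCompletion A B) := fun z z' => by
  change A.completion.eqv (A.toCompletion _) (A.toCompletion _) ⊓
    B.completion.eqv (B.toCompletion _) (B.toCompletion _) = _
  rw [A.isIsometry_toCompletion, B.isIsometry_toCompletion]
  rfl

/-- Each coordinate of `z` equals a representable to the full extent of `z`. That extent is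
idempotent, so a single pair of representables already witnesses density. -/
theorem isDense_prodToCompletion [Finite A.carrier] [Nonempty A.carrier] [Finite B.carrier]
    [Nonempty B.carrier] (hA : ∀ a, A.eqv a a = 1) (hB : ∀ b, B.eqv b b = 1) :
    IsDense (prodToCompletion A B) := fun z => by
  obtain ⟨a, ha, hz⟩ := exists_extent_le_eqv_toCompletion hA z.1.1
  obtain ⟨b, hb, -⟩ := exists_extent_le_eqv_toCompletion hB z.1.2
  let d : (A.prod B).carrier := ⟨(a, b), (hA a).trans (hB b).symm⟩
  have hd : (A.completion.prod B.completion).eqv (prodToCompletion A B d)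
      (prodToCompletion A B d) = 1 := by
    rw [isIsometry_prodToCompletion, prod_eqv_self]
    exact hA a
  have hle : A.completion.eqv z.1.1 z.1.1 ≤
      (A.completion.prod B.completion).eqv z (prodToCompletion A B d) :=
    le_inf ha (z.2.le.trans hb)
  refine le_iSup_of_le d ?_
  rw [hd, T.one_imp, (A.completion.prod B.completion).eqv_symm (prodToCompletion A B d) z,
    prod_eqv_self]
  exact hz.trans (T.op_mono _ _ _ _ hle hle)

end FiniteDense

/-! ### Test objects for the necessity of the minimum. -/

section TestObjects

variable (T)

/-- The one-point set of full extent. -/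
def point : RSet.{u} T where
  carrier := PUnit
  eqv _ _ := 1
  eqv_le _ _ := by simp
  eqv_symm _ _ := rfl
  eqv_trans _ _ _ := le_top

/-- Two elements of full extent that coincide to degree `t`. -/
def twoPoint (t : unitInterval) : RSet.{u} T where
  carrier := ULift Bool
  eqv x y := if x.down = y.down then 1 else t
  eqv_le x y := by
    simp only [if_true, inf_idem]
    exact le_top
  eqv_symm x y := by simp only [eq_comm]
  eqv_trans x y z := by
    obtain ⟨x⟩ := x
    obtain ⟨y⟩ := y
    obtain ⟨z⟩ := z
    cases x <;> cases y <;> cases z <;>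
      simp [T.one_imp, T.one_op, T.op_one, unitInterval.le_one']

/-- The unit interval with its biresiduum. -/
noncomputable def line : RSet.{u} T where
  carrier := ULift unitInterval
  eqv x y := T.imp x.down y.down ⊓ T.imp y.down x.down
  eqv_le x y := by
    simp only [imp_eq_one le_rfl, inf_idem]
    exact le_top
  eqv_symm x y := inf_comm _ _
  eqv_trans x y z := by
    have key : ∀ a b c, T.op (T.imp a b) (T.imp b c) ≤ T.imp a c := fun a b c =>
      imp_op_le (T.op_imp_le b c)
    rw [imp_eq_one (p := y.down) le_rfl, inf_idem, T.one_imp]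
    refine le_inf ?_ ?_
    · rw [T.op_comm]
      exact (T.op_mono _ _ _ _ inf_le_left inf_le_left).trans (key _ _ _)
    · exact (T.op_mono _ _ _ _ inf_le_right inf_le_right).trans (key _ _ _)

variable {T}

instance : Finite (point.{u} T).carrier := inferInstanceAs (Finite PUnit)

instance : Nonempty (point.{u} T).carrier := inferInstanceAs (Nonempty PUnit)

instance (t : unitInterval) : Finite (twoPoint.{u} T t).carrier :=
  inferInstanceAs (Finite (ULift Bool))

instance (t : unitInterval) : Nonempty (twoPoint.{u} T t).carrier :=
  inferInstanceAs (Nonempty (ULift Bool))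

theorem twoPoint_eqv_self (t : unitInterval) (x : (twoPoint.{u} T t).carrier) :
    (twoPoint.{u} T t).eqv x x = 1 :=
  if_pos rfl

theorem line_eqv_self (x : (line.{u} T).carrier) : (line.{u} T).eqv x x = 1 := by
  simp [line, imp_eq_one le_rfl]

theorem twoPoint_completion_eqv_self (t : unitInterval) (x : (twoPoint.{u} T t).carrier) :
    (twoPoint.{u} T t).completion.eqv ((twoPoint.{u} T t).toCompletion x)
      ((twoPoint.{u} T t).toCompletion x) = 1 :=
  ((twoPoint.{u} T t).isIsometry_toCompletion x x).trans (twoPoint_eqv_self t x)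

/-- A function from the product of two two-point sets to the line is monotone as soon as it is
so in each of the coordinates and on the diagonals. -/
def lineMap (t : unitInterval) (φ : Bool → Bool → unitInterval)
    (h₁ : ∀ x, t ≤ T.imp (φ x false) (φ x true) ⊓ T.imp (φ x true) (φ x false))
    (h₂ : ∀ y y', T.op t t ≤ T.imp (φ false y) (φ true y') ⊓ T.imp (φ true y') (φ false y)) :
    MonoFun ((twoPoint.{u} T (T.op t t)).prod (twoPoint.{u} T t)) (line.{u} T) where
  toFun z := ⟨φ z.1.1.down z.1.2.down⟩
  extent z := ((prod_eqv_self z).trans (twoPoint_eqv_self _ _)).trans (line_eqv_self _).symm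
  mono z z' := by
    obtain ⟨⟨⟨x⟩, ⟨y⟩⟩, hz⟩ := z
    obtain ⟨⟨⟨x'⟩, ⟨y'⟩⟩, hz'⟩ := z'
    change (if x = x' then 1 else T.op t t) ⊓ (if y = y' then 1 else t) ≤
      T.imp (φ x y) (φ x' y') ⊓ T.imp (φ x' y') (φ x y)
    rcases eq_or_ne x x' with rfl | hx
    · rcases eq_or_ne y y' with rfl | hy
      · simp [imp_eq_one le_rfl]
      · rw [if_neg hy]
        refine inf_le_right.trans ?_
        cases y <;> cases y' <;> first | exact absurd rfl hy | exact h₁ x | skip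
        rw [inf_comm]
        exact h₁ x
    · rw [if_neg hx]
      refine inf_le_left.trans ?_
      cases x <;> cases x' <;> first | exact absurd rfl hx | exact h₂ y y' | skip
      rw [inf_comm]
      exact h₂ y' y

end TestObjects

end RSet

/-! ### Comparison of an arbitrary cartesian structure with the concrete product. -/

namespace CcRSet

open RSet MonoidalCategory CartesianMonoidalCategory

variable {T : ContTNorm}

/-- The underlying monotone function of a morphism. -/
abbrev fn {X Y : CcRSet.{u} T} (f : X ⟶ Y) : MonoFun X.obj Y.obj := f.hom

/-- The morphism given by a monotone function. -/
abbrev ofFn {X Y : CcRSet.{u} T} (f : MonoFun X.obj Y.obj) : X ⟶ Y := ObjectProperty.homMk f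

/-- The Cauchy completion as an object of `CcRSet`. -/
noncomputable abbrev completion (X : RSet.{u} T) : CcRSet.{u} T :=
  ⟨X.completion, X.completion_isSeparated, X.completion_isCauchyComplete⟩

/-- The product as an object of `CcRSet`. -/
abbrev prod (X Y : CcRSet.{u} T) : CcRSet.{u} T :=
  ⟨X.obj.prod Y.obj, prod_isSeparated X.property.1 Y.property.1,
    prod_isCauchyComplete X.property.2 Y.property.2⟩

/-- The action of the product on morphisms, in the second argument. -/
abbrev prodMapRight (X : CcRSet.{u} T) {Y Y' : CcRSet.{u} T} (k : Y ⟶ Y') :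
    prod X Y ⟶ prod X Y' :=
  ofFn (prodLift (prodFst X.obj Y.obj) ((prodSnd X.obj Y.obj).comp (fn k)))

section Tensor

variable [CartesianMonoidalCategory (CcRSet.{u} T)] (X : CcRSet.{u} T) {Y Y' : CcRSet.{u} T}

variable (Y) in
/-- The comparison from the concrete product. -/
def toTensor : prod X Y ⟶ X ⊗ Y :=
  lift (ofFn (prodFst X.obj Y.obj)) (ofFn (prodSnd X.obj Y.obj))

variable (Y) in
/-- The comparison to the concrete product. -/
def ofTensor : X ⊗ Y ⟶ prod X Y :=
  ofFn (prodLift (fn (SemiCartesianMonoidalCategory.fst X Y))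
    (fn (SemiCartesianMonoidalCategory.snd X Y)))

theorem ofTensor_toTensor : ofTensor X Y ≫ toTensor X Y = 𝟙 _ := by
  apply CartesianMonoidalCategory.hom_ext
  · simp only [toTensor, Category.assoc, lift_fst, Category.id_comp]
    rfl
  · simp only [toTensor, Category.assoc, lift_snd, Category.id_comp]
    rfl

theorem toTensor_ofTensor : toTensor X Y ≫ ofTensor X Y = 𝟙 _ := by
  have h₁ := lift_fst (ofFn (X := prod X Y) (prodFst X.obj Y.obj))
    (ofFn (X := prod X Y) (Y := Y) (prodSnd X.obj Y.obj))
  have h₂ := lift_snd (ofFn (X := prod X Y) (Y := X) (prodFst X.obj Y.obj))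
    (ofFn (X := prod X Y) (prodSnd X.obj Y.obj))
  ext
  refine MonoFun.ext (funext fun z => Subtype.ext (Prod.ext ?_ ?_))
  · exact congrArg (fun k => (fn k).toFun z) h₁
  · exact congrArg (fun k => (fn k).toFun z) h₂

theorem toTensor_whiskerLeft (k : Y ⟶ Y') :
    toTensor X Y ≫ X ◁ k = prodMapRight X k ≫ toTensor X Y' := by
  apply CartesianMonoidalCategory.hom_ext
  · simp only [toTensor, Category.assoc, whiskerLeft_fst, lift_fst]
    rfl
  · simp only [toTensor, Category.assoc, whiskerLeft_snd, lift_snd, lift_snd_assoc]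
    rfl

theorem whiskerLeft_ofTensor (k : Y ⟶ Y') :
    X ◁ k ≫ ofTensor X Y' = ofTensor X Y ≫ prodMapRight X k := by
  rw [← Category.id_comp (X ◁ k), ← ofTensor_toTensor, Category.assoc, Category.assoc,
    ← Category.assoc (toTensor X Y), toTensor_whiskerLeft, Category.assoc, toTensor_ofTensor,
    Category.comp_id]

end Tensor

/-! ### Cartesian closedness forces idempotency. -/

section Closed

variable [CartesianMonoidalCategory (CcRSet.{u} T)] [MonoidalClosed (CcRSet.{u} T)]

/-- Gluing in the exponential: if two families of maps agree at a common global element, then the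
values at elements that are close to it are close too. -/
theorem op_le_eqv_of_agree {A B C W : CcRSet.{u} T} (c : C ⟶ A) (G H : prod B A ⟶ W)
    (hGH : prodMapRight B c ≫ G = prodMapRight B c ≫ H) (x : C.obj.carrier) (z : A.obj.carrier)
    (a b : B.obj.carrier) (hx : C.obj.eqv x x = 1) (hz : A.obj.eqv z z = 1)
    (ha : B.obj.eqv a a = 1) (hb : B.obj.eqv b b = 1) (t : unitInterval)
    (ht : t ≤ A.obj.eqv z ((fn c).toFun x)) (hab : T.op t t ≤ B.obj.eqv a b) :
    T.op t t ≤ W.obj.eqv ((fn G).toFun ⟨(a, z), ha.trans hz.symm⟩)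
      ((fn H).toFun ⟨(b, z), hb.trans hz.symm⟩) := by
  let E : CcRSet.{u} T := (ihom B).obj W
  let g : A ⟶ E := MonoidalClosed.curry (ofTensor B A ≫ G)
  let h : A ⟶ E := MonoidalClosed.curry (ofTensor B A ≫ H)
  have hagree : c ≫ g = c ≫ h := by
    rw [← MonoidalClosed.curry_natural_left, ← MonoidalClosed.curry_natural_left,
      ← Category.assoc, ← Category.assoc, whiskerLeft_ofTensor, Category.assoc, Category.assoc,
      hGH]
  let ev : prod B E ⟶ W := toTensor B E ≫ (ihom.ev B).app W
  have hev : ∀ K : prod B A ⟶ W,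
      prodMapRight B (MonoidalClosed.curry (ofTensor B A ≫ K)) ≫ ev = K := fun K => by
    rw [← Category.assoc, ← toTensor_whiskerLeft, Category.assoc,
      MonoidalClosed.whiskerLeft_curry_ihom_ev_app, ← Category.assoc, toTensor_ofTensor,
      Category.id_comp]
  have hpt : (fn g).toFun ((fn c).toFun x) = (fn h).toFun ((fn c).toFun x) :=
    congrArg (fun k => (fn k).toFun x) hagree
  have hg := ht.trans ((fn g).mono z _)
  have hh := ht.trans ((fn h).mono z _)
  -- Transitivity through the common value of the two transposes, which has full extent.
  have hE : T.op t t ≤ E.obj.eqv ((fn g).toFun z) ((fn h).toFun z) := by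
    refine le_trans ?_ (E.obj.eqv_op_imp _ ((fn g).toFun ((fn c).toFun x)) _)
    rw [← (fn g).extent, ← (fn c).extent, hx, T.one_imp, hpt,
      E.obj.eqv_symm _ ((fn h).toFun z), ← hpt]
    exact T.op_mono _ _ _ _ hg (hpt ▸ hh)
  have hgz : E.obj.eqv ((fn g).toFun z) ((fn g).toFun z) = 1 := ((fn g).extent z).symm.trans hz
  have hhz : E.obj.eqv ((fn h).toFun z) ((fn h).toFun z) = 1 := ((fn h).extent z).symm.trans hz
  -- The equality of the product is an infimum, so the bound `t * t` survives the pairing.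
  have key := (le_inf hab hE).trans ((fn ev).mono
    ⟨(a, (fn g).toFun z), ha.trans hgz.symm⟩ ⟨(b, (fn h).toFun z), hb.trans hhz.symm⟩)
  have eG : (fn ev).toFun ⟨(a, (fn g).toFun z), ha.trans hgz.symm⟩ =
      (fn G).toFun ⟨(a, z), ha.trans hz.symm⟩ :=
    congrArg (fun k : prod B A ⟶ W => (fn k).toFun ⟨(a, z), ha.trans hz.symm⟩) (hev G)
  have eH : (fn ev).toFun ⟨(b, (fn h).toFun z), hb.trans hhz.symm⟩ =
      (fn H).toFun ⟨(b, z), hb.trans hz.symm⟩ :=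
    congrArg (fun k : prod B A ⟶ W => (fn k).toFun ⟨(b, z), hb.trans hz.symm⟩) (hev H)
  rwa [eG, eH] at key

theorem op_self_le_op_op_self (t : unitInterval) : T.op t t ≤ T.op t (T.op t t) := by
  set p := T.op t t with hp
  have hpt : p ≤ t := T.op_le_left t t
  have htp : T.op t p ≤ p := T.op_le_right t p
  let A₀ := twoPoint.{u} T t
  let B₀ := twoPoint.{u} T p
  let C₀ := point.{u} T
  let W : CcRSet.{u} T := completion (line.{u} T)
  -- `g₀` is `1` at `(false, false)`, `t` at `(false, true)` and `p` at both `(true, _)`.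
  let g₀ : MonoFun (B₀.prod A₀) (line.{u} T) :=
    lineMap t (fun x y => cond x p (cond y t 1))
      (by
        rintro (_ | _)
        · simp [T.one_imp, imp_eq_one unitInterval.le_one', unitInterval.le_one']
        · simp [imp_eq_one le_rfl, unitInterval.le_one'])
      (by
        rintro (_ | _) y'
        · simp [T.one_imp, imp_eq_one unitInterval.le_one', unitInterval.le_one', ← hp]
        · simp only [cond_true, cond_false, imp_eq_one hpt, ← hp]
          exact le_inf ((T.op_le_iff_le_imp _ _ _).1 htp) le_top)
  -- `h₀` is `t` at both `(false, _)`, `p` at `(true, true)` and `t * p` at `(true, false)`. It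
  -- agrees with `g₀` wherever the second coordinate is `true`.
  let h₀ : MonoFun (B₀.prod A₀) (line.{u} T) :=
    lineMap t (fun x y => cond x (cond y p (T.op t p)) t)
      (by
        rintro (_ | _)
        · simp [imp_eq_one le_rfl, unitInterval.le_one']
        · simp only [cond_true, cond_false, imp_eq_one htp]
          exact le_inf le_top ((T.op_le_iff_le_imp _ _ _).1 (T.op_comm p t).le))
      (by
        rintro y (_ | _)
        · simp only [cond_true, cond_false, imp_eq_one (htp.trans hpt), ← hp]
          exact le_inf ((T.op_le_iff_le_imp _ _ _).1 le_rfl) le_top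
        · simp only [cond_true, cond_false, imp_eq_one hpt, ← hp]
          exact le_inf ((T.op_le_iff_le_imp _ _ _).1 htp) le_top)
  let η : MonoFun (line.{u} T) (line.{u} T).completion :=
    ⟨(line.{u} T).toCompletion, fun x => ((line.{u} T).isIsometry_toCompletion x x).symm,
      fun x y => ((line.{u} T).isIsometry_toCompletion x y).ge⟩
  have hdense : IsDense (prodToCompletion B₀ A₀) :=
    isDense_prodToCompletion (twoPoint_eqv_self p) (twoPoint_eqv_self t)
  obtain ⟨G, hG⟩ := exists_extension isIsometry_prodToCompletion hdense
    W.property.1 W.property.2 (g₀.comp η)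
  obtain ⟨H, hH⟩ := exists_extension isIsometry_prodToCompletion hdense
    W.property.1 W.property.2 (h₀.comp η)
  let c₀ : MonoFun C₀ A₀.completion :=
    ⟨fun _ => A₀.toCompletion ⟨true⟩,
      fun _ => (twoPoint_completion_eqv_self t ⟨true⟩).symm,
      fun _ _ => (twoPoint_completion_eqv_self t ⟨true⟩).ge⟩
  obtain ⟨c, hc⟩ := exists_extension C₀.isIsometry_toCompletion C₀.isDense_toCompletion
    A₀.completion_isSeparated A₀.completion_isCauchyComplete c₀
  have hagree : prodMapRight (completion B₀) (ofFn (X := completion C₀) (Y := completion A₀) c) ≫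
      ofFn (Y := W) G = prodMapRight (completion B₀)
        (ofFn (X := completion C₀) (Y := completion A₀) c) ≫ ofFn (Y := W) H := by
    ext
    refine (isDense_prodToCompletion (A := B₀) (B := C₀) (twoPoint_eqv_self p)
      (fun _ => rfl)).monoFun_ext W.property.1 fun d => ?_
    let d' : (B₀.prod A₀).carrier := ⟨(d.1.1, ⟨true⟩), by
      rw [twoPoint_eqv_self, twoPoint_eqv_self]⟩
    have hd' : ∀ K : MonoFun (B₀.completion.prod A₀.completion) W.obj,
        K.toFun ((prodLift (prodFst B₀.completion C₀.completion)
          ((prodSnd B₀.completion C₀.completion).comp c)).toFun (prodToCompletion B₀ C₀ d)) =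
        K.toFun (prodToCompletion B₀ A₀ d') := fun K =>
      congrArg K.toFun (Subtype.ext (Prod.ext rfl (hc d.1.2)))
    refine (hd' G).trans (Eq.trans ?_ (hd' H).symm)
    rw [hG, hH]
    rfl
  have key := op_le_eqv_of_agree (ofFn (X := completion C₀) (Y := completion A₀) c)
    (ofFn (X := prod (completion B₀) (completion A₀)) (Y := W) G)
    (ofFn (X := prod (completion B₀) (completion A₀)) (Y := W) H) hagree
    (C₀.toCompletion PUnit.unit) (A₀.toCompletion ⟨false⟩) (B₀.toCompletion ⟨false⟩)
    (B₀.toCompletion ⟨true⟩) (C₀.isIsometry_toCompletion _ _) (twoPoint_completion_eqv_self t _)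
    (twoPoint_completion_eqv_self p _) (twoPoint_completion_eqv_self p _) t ?_ ?_
  · let dG : (B₀.prod A₀).carrier := ⟨(⟨false⟩, ⟨false⟩), by
      rw [twoPoint_eqv_self, twoPoint_eqv_self]⟩
    let dH : (B₀.prod A₀).carrier := ⟨(⟨true⟩, ⟨false⟩), by
      rw [twoPoint_eqv_self, twoPoint_eqv_self]⟩
    change T.op t t ≤ W.obj.eqv (G.toFun (prodToCompletion B₀ A₀ dG))
      (H.toFun (prodToCompletion B₀ A₀ dH)) at key
    rw [hG, hH] at key
    replace key := key.trans ((line.{u} T).isIsometry_toCompletion _ _).le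
    -- The values compared are `g₀ = 1` and `h₀ = t * p`, and `1 → t * p` is `t * p`.
    exact key.trans (inf_le_left.trans (T.one_imp _).le)
  · change t ≤ A₀.completion.eqv _ (c.toFun _)
    exact (A₀.isIsometry_toCompletion ⟨false⟩ ⟨true⟩).ge.trans_eq
      (congrArg _ (hc PUnit.unit).symm)
  · exact (B₀.isIsometry_toCompletion ⟨false⟩ ⟨true⟩).ge

theorem isMin_of_monoidalClosed : T.IsMin := by
  refine isMin_of_idempotent fun p => ?_
  obtain ⟨t, rfl⟩ := T.exists_op_self_eq p
  have h := op_self_le_op_op_self.{u} (T := T) t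
  calc T.op t t ≤ T.op t (T.op t t) := h
    _ ≤ T.op t (T.op t (T.op t t)) := op_le_op_left h t
    _ = _ := by ac_rfl

end Closed

end CcRSet

namespace ContTNorm

theorem le_imp (T : ContTNorm) (p q : unitInterval) : q ≤ T.imp p q :=
  (T.op_le_iff_le_imp _ _ _).1 (T.op_le_right p q)

theorem IsMin.inf_le_iff {T : ContTNorm} (hT : T.IsMin) {p q r : unitInterval} :
    p ⊓ q ≤ r ↔ q ≤ T.imp p r := by
  rw [← T.op_le_iff_le_imp, hT]

end ContTNorm

namespace RSet

variable {T : ContTNorm}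

/-! ### The terminal object. -/

section Terminal

/-- The terminal `[0,1]_*`-set. -/
def terminal (T : ContTNorm) : RSet.{u} T where
  carrier := ULift unitInterval
  eqv x y := x.down ⊓ y.down
  eqv_le _ _ := by simp
  eqv_symm _ _ := inf_comm _ _
  eqv_trans x y z := by
    rw [inf_idem]
    refine le_inf ?_ ((T.op_le_left _ _).trans inf_le_right)
    exact (op_le_op_right inf_le_left _).trans ((T.op_imp_le _ _).trans inf_le_left)

theorem terminal_isSeparated : (terminal.{u} T).IsSeparated :=
  isSeparated_of_imp_eq fun x y h => by
    have := h.1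
    simp only [terminal, inf_idem] at this
    exact ULift.ext _ _ this

theorem terminal_isCauchyComplete : (terminal.{u} T).IsCauchyComplete := fun p l hl => by
  let x : (terminal.{u} T).carrier := ⟨p⟩
  have hx : (terminal.{u} T).eqv x x = p := inf_idem p
  refine ⟨x, hl.eq_of_le (hx ▸ isSingleton_eqv x) fun y => le_inf (hl.le_extent y) ?_⟩
  exact (hl.le_eqv y).trans inf_le_left

/-- The map to the terminal `[0,1]_*`-set, given by the extents. -/
def toTerminal (X : RSet.{v} T) : MonoFun X (terminal.{u} T) where
  toFun x := ⟨X.eqv x x⟩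
  extent _ := (inf_idem _).symm
  mono x y := X.eqv_le x y

theorem eq_toTerminal {X : RSet.{v} T} (f : MonoFun X (terminal.{u} T)) : f = X.toTerminal :=
  MonoFun.ext (funext fun x => ULift.ext _ _ (((f.extent x).trans (inf_idem _)).symm))

end Terminal

/-! ### Singletons and restrictions for the minimum. -/

section Min

theorem eqv_inf_le (hT : T.IsMin) (X : RSet.{u} T) (x y z : X.carrier) :
    X.eqv x y ⊓ X.eqv y z ≤ X.eqv x z := by
  refine le_trans ?_ (X.eqv_op_imp x y z)
  rw [hT]
  exact inf_le_inf_left _ (T.le_imp _ _)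

variable {X : RSet.{u} T} {p : unitInterval} {l : X.carrier → unitInterval}

theorem IsSingleton.of_isMin (hT : T.IsMin) (h₁ : ∀ y, l y ≤ p) (h₂ : ∀ y, l y ≤ X.eqv y y)
    (h₃ : ∀ y y', l y ⊓ X.eqv y y' ≤ l y') (h₄ : ∀ y y', l y ⊓ l y' ≤ X.eqv y y')
    (h₅ : p ≤ ⨆ z, l z) : X.IsSingleton p l := by
  have key : ∀ {a b c}, a ≤ b → T.op a (T.imp b c) ≤ a ⊓ c := fun h =>
    le_inf (T.op_le_left _ _) ((op_le_op_right h _).trans (T.op_imp_le _ _))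
  refine .of_conditions h₁ h₂ (fun y y' => (key (h₂ y)).trans (h₃ y y'))
    (fun y y' => (key (h₁ y')).trans (inf_comm (l y') _ ▸ h₄ y y'))
    (h₅.trans (iSup_mono fun z => ?_))
  rw [hT]
  exact le_inf le_rfl (T.le_imp _ _)

theorem IsSingleton.inf_le_eqv (hT : T.IsMin) (h : X.IsSingleton p l) (y y' : X.carrier) :
    l y ⊓ l y' ≤ X.eqv y y' := by
  refine le_trans ?_ (h.op_imp_le_eqv y y')
  rw [hT, inf_comm]
  exact inf_le_inf_left _ (T.le_imp _ _)

theorem IsSingleton.extent_eq_iSup (h : X.IsSingleton p l) : ⨆ z, l z = p :=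
  le_antisymm (iSup_le h.le_extent) (h.le_iSup.trans (iSup_mono fun _ => T.op_le_left _ _))

/-- For the minimum, `p ⊓ α(x,-)` is a singleton of extent `p ⊓ α(x,x)`, attained at `x` itself. -/
theorem exists_restriction (hT : T.IsMin) (hX : X.IsCauchyComplete) (x : X.carrier) (p : unitInterval) :
    ∃ r, ∀ y, X.eqv r y = p ⊓ X.eqv x y := by
  obtain ⟨r, hr⟩ := hX (p ⊓ X.eqv x x) (fun y => p ⊓ X.eqv x y) <| by
    refine .of_isMin hT (fun y => inf_le_inf_left _ (X.eqv_le_left x y))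
      (fun y => inf_le_right.trans (X.eqv_le_right x y)) (fun y y' => ?_) (fun y y' => ?_)
      (le_iSup (fun y => p ⊓ X.eqv x y) x)
    · rw [inf_assoc]
      exact inf_le_inf_left _ (eqv_inf_le hT X _ _ _)
    · refine (inf_le_inf inf_le_right inf_le_right).trans ?_
      rw [X.eqv_symm x y]
      exact eqv_inf_le hT X _ _ _
  exact ⟨r, fun y => (congrFun hr y).symm⟩

end Min

section Restriction

variable {X : RSet.{u} T} (hT : T.IsMin) (hX : X.IsCauchyComplete)

/-- The restriction of an element to a smaller extent. -/
noncomputable def restrict (x : X.carrier) (p : unitInterval) : X.carrier :=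
  (exists_restriction hT hX x p).choose

theorem restrict_eqv (x : X.carrier) (p : unitInterval) (y : X.carrier) :
    X.eqv (restrict hT hX x p) y = p ⊓ X.eqv x y :=
  (exists_restriction hT hX x p).choose_spec y

theorem restrict_eqv_restrict (x x' : X.carrier) (p p' : unitInterval) :
    X.eqv (restrict hT hX x p) (restrict hT hX x' p') = p ⊓ p' ⊓ X.eqv x x' := by
  rw [restrict_eqv, X.eqv_symm, restrict_eqv, X.eqv_symm, inf_assoc]

theorem restrict_eqv_self (x : X.carrier) (p : unitInterval) :
    X.eqv (restrict hT hX x p) (restrict hT hX x p) = p ⊓ X.eqv x x := by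
  rw [restrict_eqv_restrict, inf_idem]

end Restriction

/-! ### Exponentials for the minimum. -/

section Exponential

variable (A : RSet.{u} T) (Y : RSet.{v} T)

/-- A monotone function defined on the elements of `A` of extent at most `extent`, extended to all
of `A` by restriction. -/
@[ext]
structure PartialFun where
  /-- the extent of the domain -/
  extent : unitInterval
  /-- the underlying function -/
  toFun : A.carrier → Y.carrier
  eqv_self : ∀ a, Y.eqv (toFun a) (toFun a) = extent ⊓ A.eqv a a
  mono : ∀ a a', extent ⊓ A.eqv a a' ≤ Y.eqv (toFun a) (toFun a')

variable {A Y}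

/-- The degree to which two partial functions coincide. -/
noncomputable def PartialFun.eqv (f g : PartialFun A Y) : unitInterval :=
  f.extent ⊓ g.extent ⊓ ⨅ a, T.imp (A.eqv a a) (Y.eqv (f.toFun a) (g.toFun a))

namespace PartialFun

theorem le_eqv_iff (hT : T.IsMin) {f g : PartialFun A Y} {r : unitInterval} :
    r ≤ f.eqv g ↔ r ≤ f.extent ∧ r ≤ g.extent ∧
      ∀ a, A.eqv a a ⊓ r ≤ Y.eqv (f.toFun a) (g.toFun a) := by
  simp only [eqv, le_inf_iff, le_iInf_iff, hT.inf_le_iff, and_assoc]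

theorem inf_eqv_le (hT : T.IsMin) (f g : PartialFun A Y) (a : A.carrier) :
    A.eqv a a ⊓ f.eqv g ≤ Y.eqv (f.toFun a) (g.toFun a) :=
  ((le_eqv_iff hT).1 le_rfl).2.2 a

theorem eqv_le_left (f g : PartialFun A Y) : f.eqv g ≤ f.extent :=
  inf_le_left.trans inf_le_left

theorem eqv_le_right (f g : PartialFun A Y) : f.eqv g ≤ g.extent :=
  inf_le_left.trans inf_le_right

theorem extent_eqv (hT : T.IsMin) (f : PartialFun A Y) : f.eqv f = f.extent :=
  le_antisymm (eqv_le_left f f) ((le_eqv_iff hT).2 ⟨le_rfl, le_rfl, fun a => by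
    rw [f.eqv_self, inf_comm]⟩)

end PartialFun

variable (A Y) in
/-- The exponential of `[0,1]`-sets for the minimum t-norm. -/
noncomputable abbrev exponential (hT : T.IsMin) : RSet.{max u v} T where
  carrier := PartialFun A Y
  eqv := PartialFun.eqv
  eqv_le f g := by
    rw [f.extent_eqv hT, g.extent_eqv hT]
    exact le_inf (f.eqv_le_left g) (f.eqv_le_right g)
  eqv_symm f g := by simp only [PartialFun.eqv, inf_comm f.extent, Y.eqv_symm]
  eqv_trans f g h := by
    have h₁ : T.op (g.eqv h) (T.imp (g.eqv g) (f.eqv g)) ≤ f.eqv g := by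
      refine (op_le_op_right ?_ _).trans (T.op_imp_le _ _)
      rw [g.extent_eqv hT]
      exact g.eqv_le_left h
    have h₂ := T.op_le_left (g.eqv h) (T.imp (g.eqv g) (f.eqv g))
    refine (PartialFun.le_eqv_iff hT).2 ⟨h₁.trans (f.eqv_le_left g),
      h₂.trans (g.eqv_le_right h), fun a => ?_⟩
    exact (le_inf ((inf_le_inf_left _ h₁).trans (f.inf_eqv_le hT g a))
      ((inf_le_inf_left _ h₂).trans (g.inf_eqv_le hT h a))).trans (eqv_inf_le hT Y _ _ _)

theorem exponential_eqv_self (hT : T.IsMin) (f : PartialFun A Y) :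
    (exponential A Y hT).eqv f f = f.extent :=
  f.extent_eqv hT

theorem exponential_isSeparated (hT : T.IsMin) (hY : Y.IsSeparated) :
    (exponential A Y hT).IsSeparated :=
  isSeparated_of_imp_eq fun f g h => by
    have h₁ : f.extent = g.extent := by
      rw [← exponential_eqv_self hT, ← exponential_eqv_self hT, h.1]
    have h₂ : g.extent ≤ PartialFun.eqv f g := by
      rw [← exponential_eqv_self hT]
      exact h.2.le
    refine PartialFun.ext h₁ (funext fun a => hY.eq (f.eqv_self a) ?_ ?_)
    · rw [g.eqv_self, h₁]
    · rw [h₁, inf_comm]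
      exact (inf_le_inf_left _ h₂).trans (PartialFun.inf_eqv_le hT f g a)

/-- The value at `a` of a singleton of partial functions. -/
noncomputable def evalSingleton (l : PartialFun A Y → unitInterval) (a : A.carrier)
    (y : Y.carrier) : unitInterval :=
  ⨆ f : PartialFun A Y, l f ⊓ Y.eqv (f.toFun a) y

/-- Partial functions `f`, `g` coincide at least to degree `l f ⊓ l g`, so their values at `a` are
compatible. Totality is witnessed by the values `f a`. -/
theorem isSingleton_evalSingleton (hT : T.IsMin) {s : unitInterval}
    {l : PartialFun A Y → unitInterval} (hl : (exponential A Y hT).IsSingleton s l)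
    (a : A.carrier) : Y.IsSingleton (s ⊓ A.eqv a a) (evalSingleton l a) := by
  have hle : ∀ f : PartialFun A Y, l f ≤ f.extent := fun f =>
    (hl.le_eqv f).trans (exponential_eqv_self hT f).le
  refine .of_isMin hT (fun y => iSup_le fun f => inf_le_inf (hl.le_extent f) ?_)
    (fun y => iSup_le fun f => inf_le_right.trans (Y.eqv_le_right _ _))
    (fun y y' => ?_) (fun y y' => ?_) ?_
  · exact (Y.eqv_le_left _ _).trans ((f.eqv_self a).le.trans inf_le_right)
  · rw [evalSingleton, iSup_inf_eq]
    refine iSup_mono fun f => ?_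
    rw [inf_assoc]
    exact inf_le_inf_left _ (eqv_inf_le hT Y _ _ _)
  · rw [evalSingleton, evalSingleton, iSup_inf_eq]
    refine iSup_le fun f => ?_
    rw [inf_iSup_eq]
    refine iSup_le fun g => ?_
    have hfg : l f ⊓ Y.eqv (f.toFun a) y ⊓ (l g ⊓ Y.eqv (g.toFun a) y') ≤
        Y.eqv (f.toFun a) (g.toFun a) := by
      refine le_trans (le_inf ?_ ?_) (PartialFun.inf_eqv_le hT f g a)
      · exact inf_le_left.trans (inf_le_right.trans ((Y.eqv_le_left _ _).trans
          ((f.eqv_self a).le.trans inf_le_right)))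
      · exact (inf_le_inf inf_le_left inf_le_left).trans (IsSingleton.inf_le_eqv hT hl f g)
    refine (le_inf (inf_le_left.trans inf_le_right)
      (le_inf hfg (inf_le_right.trans inf_le_right))).trans ?_
    rw [Y.eqv_symm _ y]
    exact (inf_le_inf_left _ (eqv_inf_le hT Y _ _ _)).trans (eqv_inf_le hT Y _ _ _)
  · rw [← hl.extent_eq_iSup, iSup_inf_eq]
    refine iSup_le fun f => le_iSup_of_le (f.toFun a) (le_iSup_of_le f ?_)
    rw [f.eqv_self]
    exact le_inf inf_le_left (inf_le_inf_right _ (hle f))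

/-- The representing function is glued pointwise from the evaluated singletons. It agrees with each
`f` to degree `l f`, and inherits monotonicity because these degrees have supremum `s`. -/
theorem exponential_isCauchyComplete (hT : T.IsMin) (hY : Y.IsCauchyComplete) :
    (exponential A Y hT).IsCauchyComplete := fun s l hl => by
  have hle : ∀ f : PartialFun A Y, l f ≤ f.extent := fun f =>
    (hl.le_eqv f).trans (exponential_eqv_self hT f).le
  have hev := isSingleton_evalSingleton hT hl
  choose F hF using fun a => hY _ _ (hev a)
  have hFl : ∀ (f : PartialFun A Y) a y, l f ⊓ Y.eqv (f.toFun a) y ≤ Y.eqv (F a) y :=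
    fun f a y => by
      rw [← hF a]
      exact le_iSup (fun f : PartialFun A Y => l f ⊓ Y.eqv (f.toFun a) y) f
  let φ : PartialFun A Y :=
    { extent := s
      toFun := F
      eqv_self := fun a => (hF a ▸ hev a).extent_eq
      mono := fun a a' => by
        rw [← hl.extent_eq_iSup, iSup_inf_eq]
        refine iSup_le fun f => ?_
        have h₁ : l f ⊓ A.eqv a a' ≤ Y.eqv (F a) (f.toFun a') :=
          (le_inf inf_le_left ((inf_le_inf_right _ (hle f)).trans (f.mono a a'))).trans
            (hFl f a _)
        have h₂ : l f ⊓ A.eqv a a' ≤ Y.eqv (f.toFun a') (F a') := by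
          rw [Y.eqv_symm]
          refine le_trans (le_inf inf_le_left ?_) (hFl f a' _)
          rw [f.eqv_self]
          exact inf_le_inf (hle f) (A.eqv_le_right a a')
        exact (le_inf h₁ h₂).trans (eqv_inf_le hT Y _ _ _) }
  have hφ : (exponential A Y hT).eqv φ φ = s := exponential_eqv_self hT φ
  refine ⟨φ, hl.eq_of_le (hφ ▸ isSingleton_eqv (X := RSet.exponential A Y hT) φ) fun f => ?_⟩
  refine (PartialFun.le_eqv_iff hT).2 ⟨hl.le_extent f, hle f, fun a => ?_⟩
  refine le_trans (le_inf inf_le_right ?_) (hFl f a _)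
  rw [f.eqv_self, inf_comm]
  exact inf_le_inf_right _ (hle f)

end Exponential

/-! ### Currying. -/

section Curry

variable {A : RSet.{u} T} {X : RSet.{v} T} {Y : RSet.{w} T}

/-- The pair of the restrictions of two elements to their common extent. -/
noncomputable def restrictPair (hT : T.IsMin) (hA : A.IsCauchyComplete)
    (hX : X.IsCauchyComplete) (a : A.carrier) (x : X.carrier) : (A.prod X).carrier :=
  ⟨(restrict hT hA a (X.eqv x x), restrict hT hX x (A.eqv a a)), by
    rw [restrict_eqv_self, restrict_eqv_self, inf_comm]⟩

theorem restrictPair_eqv_self (hT : T.IsMin) (hA : A.IsCauchyComplete)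
    (hX : X.IsCauchyComplete) (a : A.carrier) (x : X.carrier) :
    (A.prod X).eqv (restrictPair hT hA hX a x) (restrictPair hT hA hX a x) =
      X.eqv x x ⊓ A.eqv a a :=
  (prod_eqv_self _).trans (restrict_eqv_self hT hA a _)

theorem le_restrictPair_eqv (hT : T.IsMin) (hA : A.IsCauchyComplete)
    (hX : X.IsCauchyComplete) (a a' : A.carrier) (x x' : X.carrier) :
    A.eqv a a' ⊓ X.eqv x x' ≤
      (A.prod X).eqv (restrictPair hT hA hX a x) (restrictPair hT hA hX a' x') := by
  have h₁ := A.eqv_le a a'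
  have h₂ := X.eqv_le x x'
  refine le_inf ((le_inf (inf_le_right.trans h₂) inf_le_left).trans_eq
    (restrict_eqv_restrict hT hA a a' _ _).symm)
    ((le_inf (inf_le_left.trans h₁) inf_le_right).trans_eq
    (restrict_eqv_restrict hT hX x x' _ _).symm)

/-- The partial function obtained by fixing the second argument. -/
noncomputable def curryAt (hT : T.IsMin) (hA : A.IsCauchyComplete) (hX : X.IsCauchyComplete)
    (φ : MonoFun (A.prod X) Y) (x : X.carrier) : PartialFun A Y where
  extent := X.eqv x x
  toFun a := φ.toFun (restrictPair hT hA hX a x)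
  eqv_self a := by rw [← φ.extent, restrictPair_eqv_self]
  mono a a' := by
    rw [inf_comm]
    exact (le_restrictPair_eqv hT hA hX a a' x x).trans (φ.mono _ _)

/-- Currying for the minimum t-norm. -/
noncomputable def curry (hT : T.IsMin) (hA : A.IsCauchyComplete) (hX : X.IsCauchyComplete)
    (φ : MonoFun (A.prod X) Y) : MonoFun X (exponential A Y hT) where
  toFun := curryAt hT hA hX φ
  extent x := (PartialFun.extent_eqv hT (curryAt hT hA hX φ x)).symm
  mono x x' := (PartialFun.le_eqv_iff hT).2 ⟨X.eqv_le_left x x', X.eqv_le_right x x',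
    fun a => (le_restrictPair_eqv hT hA hX a a x x').trans (φ.mono _ _)⟩

theorem inf_le_eqv_apply (hT : T.IsMin) (ψ : MonoFun X (exponential A Y hT)) (a a' : A.carrier)
    (x x' : X.carrier) : A.eqv a a' ⊓ X.eqv x x' ≤
      Y.eqv ((ψ.toFun x).toFun a) (PartialFun.toFun (ψ.toFun x') a') := by
  have hψ : (ψ.toFun x).extent = X.eqv x x :=
    (exponential_eqv_self hT _).symm.trans (ψ.extent x).symm
  have h₁ : A.eqv a a' ⊓ X.eqv x x' ≤
      Y.eqv ((ψ.toFun x).toFun a) ((ψ.toFun x).toFun a') := by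
    refine le_trans (le_inf ?_ inf_le_left) ((ψ.toFun x).mono a a')
    rw [hψ]
    exact inf_le_right.trans (X.eqv_le_left _ _)
  have h₂ : A.eqv a a' ⊓ X.eqv x x' ≤
      Y.eqv ((ψ.toFun x).toFun a') (PartialFun.toFun (ψ.toFun x') a') :=
    (inf_le_inf (A.eqv_le_right a a') (ψ.mono x x')).trans (PartialFun.inf_eqv_le hT _ _ a')
  exact (le_inf h₁ h₂).trans (eqv_inf_le hT Y _ _ _)

theorem eqv_self_apply (hT : T.IsMin) (ψ : MonoFun X (exponential A Y hT)) (a : A.carrier)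
    (x : X.carrier) : Y.eqv ((ψ.toFun x).toFun a) (PartialFun.toFun (ψ.toFun x) a) =
      X.eqv x x ⊓ A.eqv a a := by
  rw [PartialFun.eqv_self, ← exponential_eqv_self hT, ← ψ.extent]

/-- Uncurrying for the minimum t-norm. -/
def uncurry (hT : T.IsMin) (ψ : MonoFun X (exponential A Y hT)) : MonoFun (A.prod X) Y where
  toFun z := (ψ.toFun z.1.2).toFun z.1.1
  extent z := by rw [eqv_self_apply, prod_eqv_self, ← z.2, inf_idem]
  mono z z' := inf_le_eqv_apply hT ψ _ _ _ _

theorem uncurry_curry (hT : T.IsMin) (hA : A.IsCauchyComplete) (hX : X.IsCauchyComplete)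
    (hY : Y.IsSeparated) (φ : MonoFun (A.prod X) Y) :
    uncurry hT (curry hT hA hX φ) = φ := by
  refine MonoFun.ext (funext fun z => hY.eq (p := (A.prod X).eqv z z) ?_ (φ.extent z).symm ?_)
  · rw [← MonoFun.extent]
  -- The coordinates of `z` already have equal extent, so restricting them changes nothing up to the
  -- extent of `z`.
  · refine le_trans (le_inf ?_ ?_) (φ.mono (restrictPair hT hA hX z.1.1 z.1.2) z)
    · refine le_trans (le_inf ?_ inf_le_left) (restrict_eqv hT hA _ _ _).ge
      exact inf_le_right
    · refine le_trans (le_inf ?_ inf_le_right) (restrict_eqv hT hX _ _ _).ge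
      exact inf_le_left

theorem curry_uncurry (hT : T.IsMin) (hA : A.IsCauchyComplete) (hX : X.IsCauchyComplete)
    (hY : Y.IsSeparated) (ψ : MonoFun X (exponential A Y hT)) :
    curry hT hA hX (uncurry hT ψ) = ψ := by
  refine MonoFun.ext (funext fun x => PartialFun.ext ?_ (funext fun a => ?_))
  · exact (ψ.extent x).trans (exponential_eqv_self hT _)
  · refine hY.eq (p := X.eqv x x ⊓ A.eqv a a) ?_ (eqv_self_apply hT ψ a x) ?_
    · exact ((uncurry hT ψ).extent _).symm.trans (restrictPair_eqv_self hT hA hX a x)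
    · refine le_trans (le_inf ?_ ?_) (inf_le_eqv_apply hT ψ (restrict hT hA a (X.eqv x x)) a
        (restrict hT hX x (A.eqv a a)) x)
      · rw [restrict_eqv]
      · rw [restrict_eqv, inf_comm]

end Curry

end RSet

/-! ### The cartesian closed structure. -/

namespace CcRSet

open RSet MonoidalCategory

variable {T : ContTNorm}

/-- The terminal object. -/
abbrev terminal (T : ContTNorm) : CcRSet.{u} T :=
  ⟨RSet.terminal T, terminal_isSeparated, terminal_isCauchyComplete⟩

/-- `CcRSet` has finite products. -/
@[reducible]
def cartesianMonoidalCategory (T : ContTNorm) : CartesianMonoidalCategory (CcRSet.{u} T) :=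
  .ofChosenFiniteProducts
    ⟨_, Limits.IsTerminal.ofUniqueHom (Y := terminal T) (fun X => ofFn X.obj.toTerminal)
      fun _ f => ObjectProperty.hom_ext _ (eq_toTerminal (fn f))⟩
    fun X Y => ⟨Limits.BinaryFan.mk (P := prod X Y) (ofFn (prodFst X.obj Y.obj))
        (ofFn (prodSnd X.obj Y.obj)),
      Limits.BinaryFan.isLimitMk (fun s => ofFn (prodLift (fn s.fst) (fn s.snd)))
        (fun _ => rfl) (fun _ => rfl) fun s m h₁ h₂ => by
          ext
          refine MonoFun.ext (funext fun z => Subtype.ext (Prod.ext ?_ ?_))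
          · exact congrArg (fun k => (fn k).toFun z) h₁
          · exact congrArg (fun k => (fn k).toFun z) h₂⟩

/-- The exponential object for the minimum t-norm. -/
noncomputable abbrev exponential (hT : T.IsMin) (A Y : CcRSet.{u} T) : CcRSet.{u} T :=
  ⟨RSet.exponential A.obj Y.obj hT, exponential_isSeparated hT Y.property.1,
    exponential_isCauchyComplete hT Y.property.2⟩

section

variable [CartesianMonoidalCategory (CcRSet.{u} T)] (hT : T.IsMin)

/-- The exponential adjunction on hom-sets. -/
noncomputable def tensorHomEquiv (A X Y : CcRSet.{u} T) :
    (A ⊗ X ⟶ Y) ≃ (X ⟶ exponential hT A Y) where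
  toFun φ := ofFn (RSet.curry hT A.property.2 X.property.2 (fn (toTensor A X ≫ φ)))
  invFun ψ := ofTensor A X ≫ ofFn (X := prod A X) (RSet.uncurry hT (fn ψ))
  left_inv φ := by
    have h : ofFn (X := prod A X) (RSet.uncurry hT (RSet.curry hT A.property.2 X.property.2
        (fn (toTensor A X ≫ φ)))) = toTensor A X ≫ φ := by
      ext
      exact uncurry_curry hT A.property.2 X.property.2 Y.property.1 _
    refine (congrArg (ofTensor A X ≫ ·) h).trans ?_
    rw [← Category.assoc, ofTensor_toTensor, Category.id_comp]
  right_inv ψ := by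
    dsimp only
    rw [← Category.assoc, toTensor_ofTensor, Category.id_comp]
    ext
    exact curry_uncurry hT A.property.2 X.property.2 Y.property.1 (fn ψ)

theorem tensorHomEquiv_naturality (A : CcRSet.{u} T) {X' X : CcRSet.{u} T} (Y : CcRSet.{u} T)
    (f : X' ⟶ X) (φ : A ⊗ X ⟶ Y) :
    tensorHomEquiv hT A X' Y (A ◁ f ≫ φ) = f ≫ tensorHomEquiv hT A X Y φ := by
  apply (tensorHomEquiv hT A X' Y).symm.injective
  rw [Equiv.symm_apply_apply]
  change _ = ofTensor A X' ≫ prodMapRight A f ≫ ofFn (X := prod A X)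
    (RSet.uncurry hT (fn (tensorHomEquiv hT A X Y φ)))
  rw [← Category.assoc, ← whiskerLeft_ofTensor, Category.assoc]
  exact congrArg (A ◁ f ≫ ·) ((tensorHomEquiv hT A X Y).symm_apply_apply φ).symm

/-- For the minimum t-norm, `CcRSet` is cartesian closed. -/
@[reducible]
noncomputable def monoidalClosed : MonoidalClosed (CcRSet.{u} T) where
  closed A :=
    { rightAdj := Adjunction.rightAdjointOfEquiv (F := tensorLeft A)
        (fun X Y => tensorHomEquiv hT A X Y)
        fun _ _ Y f φ => tensorHomEquiv_naturality hT A Y f φ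
      adj := Adjunction.adjunctionOfEquivRight (F := tensorLeft A)
        (fun X Y => tensorHomEquiv hT A X Y)
        fun _ _ Y f φ => tensorHomEquiv_naturality hT A Y f φ }

end

end CcRSet

theorem mainTheorem2 (T : ContTNorm) :
    IsCartesianClosed (CcRSet.{u} T) ↔ T.IsMin := by
  constructor
  · rintro ⟨_, ⟨_⟩⟩
    exact CcRSet.isMin_of_monoidalClosed.{u}
  · intro hT
    let _ := CcRSet.cartesianMonoidalCategory.{u} T
    exact ⟨inferInstance, ⟨CcRSet.monoidalClosed hT⟩⟩
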